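/- A group $G$ is said to have polynomial growth if there are a finite symmetric generating set $\Sigma$ of $G$ and constants $d, B \in \mathbb{R}$ such that $|\Sigma^r| \leq B r^d$ for all integers $r \geq 1$, where $\Sigma^r = \{s_1 \cdots s_r : s_1, \dots, s_r \in \Sigma\}$. A group is virtually abelian if it has an abelian subgroup of finite index. Let $n$ be a non-negative integer, let $\mathrm{U}_n(\mathbb{C})$ be the group of unitary $n \times n$ complex matrices, and let $G \leq \mathrm{U}_n(\mathbb{C})$ be a finitely generated subgroup with polynomial growth. Then $G$ is virtually abelian. -/

import Mathlib

open scoped Pointwise in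
open scoped Classical in
/-- A group has *polynomial growth* if for some finite symmetric generating set `S` and some
constants `d`, `B` one has `|S ^ r| ≤ B * r ^ d` for all integers `r ≥ 1`.  Here `S ^ r` is the
`r`-fold product set `{s₁ ⋯ sᵣ | sᵢ ∈ S}`. -/
def HasPolynomialGrowth (G : Type*) [Group G] : Prop :=
  ∃ (S : Finset G) (d B : ℝ), S⁻¹ = S ∧ Subgroup.closure (S : Set G) = ⊤ ∧
    ∀ r : ℕ, 1 ≤ r → ((S ^ r).card : ℝ) ≤ B * (r : ℝ) ^ d

/-- A group is *virtually abelian* if it has an abelian subgroup of finite index. -/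
def IsVirtuallyAbelian (G : Type*) [Group G] : Prop :=
  ∃ H : Subgroup G, (∀ x ∈ H, ∀ y ∈ H, x * y = y * x) ∧ H.FiniteIndex

/-!
The argument works in the unitary group of a real normed `C⋆`-ring, with the bi-invariant metric
`dist u v = ‖u - v‖`.  Since `⁅u, v⁆ - 1` is the ring commutator of `u - 1` and `v - 1` times a
unitary, one has `dist ⁅u, v⁆ 1 ≤ 2 * dist u 1 * dist v 1` (`dist_commutatorElement_one_le`).
Moreover, the unitary group has no small subgroups, so if `v` is near `1` and `u` commutes with
`⁅u, v⁆`, then `u` commutes with `v` (`commute_of_commute_commutatorElement`).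

Hence two noncommuting elements `g`, `h` close to `1` yield an infinite sequence `x₀ = h`,
`xₖ₊₁ = ⁅g, xₖ⁆` of nontrivial elements tending to `1` at a fast geometric rate, while the word
length of `xₖ` is at most a constant times `4 ^ k`.  By lacunarity the `M ^ m` products
`x₀ ^ i₀ ⋯ xₘ₋₁ ^ iₘ₋₁` with `iⱼ < M` are distinct (`exists_separated_products`), and they all lie
in a ball of radius `O(M * 4 ^ m)`.  Taking `M = 4 ^ (D + 1)`, this contradicts growth of degree
`D` as soon as `g` and `h` are within `1 / (12 * M)` of `1` (`commute_of_card_pow_le`,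
`HasPolynomialGrowth.exists_commute_of_dist_lt`).

So in a group of polynomial growth all elements sufficiently close to `1` commute with one another.
In the compact group of unitary matrices they generate a subgroup of finite index, because its
cosets are uniformly separated (`finiteIndex_closure_dist_lt`).
-/

open scoped Pointwise Classical commutatorElement

/-! ### The bi-invariant metric on the unitary group -/

section Unitary

variable {A : Type*} [NormedRing A] [StarRing A] [CStarRing A]

theorem unitary_dist_mul_left (w u v : unitary A) : dist (w * u) (w * v) = dist u v := by
  rw [Subtype.dist_eq, Subtype.dist_eq, dist_eq_norm, dist_eq_norm, Submonoid.coe_mul,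
    Submonoid.coe_mul, ← mul_sub, CStarRing.norm_coe_unitary_mul]

theorem unitary_dist_mul_right (w u v : unitary A) : dist (u * w) (v * w) = dist u v := by
  rw [Subtype.dist_eq, Subtype.dist_eq, dist_eq_norm, dist_eq_norm, Submonoid.coe_mul,
    Submonoid.coe_mul, ← sub_mul, CStarRing.norm_mul_coe_unitary]

theorem unitary_dist_self_mul (u v : unitary A) : dist u (u * v) = dist v 1 := by
  simpa [dist_comm] using unitary_dist_mul_left u 1 v

theorem unitary_dist_pow_one_le (u : unitary A) (k : ℕ) : dist (u ^ k) 1 ≤ k * dist u 1 := by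
  induction k with
  | zero => simp
  | succ k ih =>
    have h₁ := dist_triangle_left (u ^ k * u) 1 (u ^ k)
    rw [unitary_dist_self_mul] at h₁
    rw [pow_succ]
    push_cast
    linarith

theorem dist_commutatorElement_one_le (u v : unitary A) :
    dist ⁅u, v⁆ 1 ≤ 2 * dist u 1 * dist v 1 := by
  have h₁ : dist ⁅u, v⁆ 1 = dist (u * v) (v * u) := by
    rw [← unitary_dist_mul_right (v * u), commutatorElement_def]
    congr 1 <;> group
  have h₂ : (u * v - v * u : A) = (u - 1) * (v - 1) - (v - 1) * (u - 1) := by noncomm_ring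
  rw [h₁]
  simp only [Subtype.dist_eq, dist_eq_norm, Submonoid.coe_mul, OneMemClass.coe_one]
  rw [h₂]
  have h₃ := norm_sub_le ((u - 1 : A) * (v - 1)) ((v - 1) * (u - 1))
  have h₄ := norm_mul_le (u - 1 : A) (v - 1)
  have h₅ := norm_mul_le (v - 1 : A) (u - 1)
  linarith

/-- Powers of a unitary near `1` are linear in the exponent up to a quadratic error. -/
theorem norm_pow_sub_one_sub_le (u : unitary A) (k : ℕ) :
    ‖((u : A) ^ k - 1) - k * ((u : A) - 1)‖ ≤ (k * dist u 1) ^ 2 := by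
  induction k with
  | zero => simp
  | succ k ih =>
    have h₁ : ((u : A) ^ (k + 1) - 1) - ((k + 1 : ℕ) : A) * ((u : A) - 1) =
        (((u : A) ^ k - 1) - k * ((u : A) - 1)) + ((u : A) - 1) * ((u : A) ^ k - 1) := by
      rw [pow_succ']
      push_cast
      noncomm_ring
    have h₂ := unitary_dist_pow_one_le u k
    have h₃ : ‖((u : A) - 1) * ((u : A) ^ k - 1)‖ ≤ dist u 1 * (k * dist u 1) := by
      refine (norm_mul_le _ _).trans ?_
      simp only [Subtype.dist_eq, dist_eq_norm, SubmonoidClass.coe_pow,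
        OneMemClass.coe_one] at h₂ ⊢
      gcongr
    rw [h₁]
    refine (norm_add_le _ _).trans ?_
    push_cast
    nlinarith [mul_nonneg (Nat.cast_nonneg (α := ℝ) k) (sq_nonneg (dist u 1)),
      sq_nonneg (dist u 1)]

theorem half_dist_le_dist_pow_one [NormedAlgebra ℝ A] (u : unitary A) {k : ℕ} (hk : 1 ≤ k)
    (hu : k * dist u 1 ≤ 1 / 2) : dist u 1 / 2 ≤ dist (u ^ k) 1 := by
  have h₁ := norm_pow_sub_one_sub_le u k
  have h₂ : ‖(k : A) * ((u : A) - 1)‖ = k * dist u 1 := by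
    rw [← nsmul_eq_mul, ← Nat.cast_smul_eq_nsmul ℝ, norm_smul, Subtype.dist_eq, dist_eq_norm]
    simp
  have h₃ : dist (u ^ k) 1 = ‖(u : A) ^ k - 1‖ := by
    rw [Subtype.dist_eq, dist_eq_norm]
    simp
  have h₄ := norm_sub_norm_le ((k : A) * ((u : A) - 1)) ((u : A) ^ k - 1)
  rw [norm_sub_rev (k * ((u : A) - 1))] at h₄
  have h₅ : (1 : ℝ) ≤ k := by exact_mod_cast hk
  have h₆ : dist u 1 ≤ k * dist u 1 := le_mul_of_one_le_left dist_nonneg h₅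
  have h₇ : 0 ≤ dist u 1 := dist_nonneg
  nlinarith

/-! ### No small subgroups, and commutators near the identity -/

omit [CStarRing A] in
/-- The unitary group has no small subgroups: squaring a nontrivial element within `1 / 2` of `1`
moves it away from `1` by a factor of at least `3 / 2`. -/
theorem eq_one_of_forall_dist_pow_le [NormedAlgebra ℝ A] (c : unitary A)
    (hc : ∀ k : ℕ, dist (c ^ k) 1 ≤ 1 / 2) :
    c = 1 := by
  have hsq : ∀ u : unitary A, dist u 1 ≤ 1 / 2 → 3 / 2 * dist u 1 ≤ dist (u ^ 2) 1 := by
    intro u hu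
    simp only [Subtype.dist_eq, dist_eq_norm, SubmonoidClass.coe_pow,
      OneMemClass.coe_one] at hu ⊢
    have h₁ : ((u : A) - 1) + ((u : A) - 1) =
        ((u : A) ^ 2 - 1) - ((u : A) - 1) * ((u : A) - 1) := by noncomm_ring
    have h₂ := norm_sub_le ((u : A) ^ 2 - 1) (((u : A) - 1) * ((u : A) - 1))
    have h₃ := norm_mul_le ((u : A) - 1) ((u : A) - 1)
    have h₄ : ‖((u : A) - 1) + ((u : A) - 1)‖ = 2 * ‖(u : A) - 1‖ := by
      rw [← two_smul ℝ, norm_smul, Real.norm_ofNat]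
    rw [← h₁, h₄] at h₂
    nlinarith [norm_nonneg ((u : A) - 1)]
  have hpow : ∀ k : ℕ, (3 / 2 : ℝ) ^ k * dist c 1 ≤ dist (c ^ 2 ^ k) 1 := by
    intro k
    induction k with
    | zero => simp
    | succ k ih =>
      have := hsq _ (hc (2 ^ k))
      rw [← pow_mul, ← pow_succ] at this
      rw [pow_succ]
      linarith
  by_contra hne
  have hpos : 0 < dist c 1 := dist_pos.2 hne
  obtain ⟨k, hk⟩ := pow_unbounded_of_one_lt (1 / 2 / dist c 1) (by norm_num : (1 : ℝ) < 3 / 2)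
  rw [div_lt_iff₀ hpos] at hk
  linarith [hpow k, hc (2 ^ k)]

/-- If `u` commutes with `c = ⁅u, v⁆`, then `c ^ k * v = u ^ k * v * (u ^ k)⁻¹` is as close
to `1` as `v` is, so that all powers of `c` stay near `1`. -/
theorem commute_of_commute_commutatorElement [NormedAlgebra ℝ A] {u v : unitary A}
    (hv : dist v 1 ≤ 1 / 4) (h : Commute u ⁅u, v⁆) : Commute u v := by
  rw [← commutatorElement_eq_one_iff_commute]
  refine eq_one_of_forall_dist_pow_le _ fun k ↦ ?_
  have hconj : ∀ k : ℕ, ⁅u, v⁆ ^ k * v * u ^ k = u ^ k * v := by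
    intro k
    induction k with
    | zero => simp
    | succ k ih =>
      have h₁ : ⁅u, v⁆ * v * u = u * v := by rw [commutatorElement_def]; group
      calc ⁅u, v⁆ ^ (k + 1) * v * u ^ (k + 1)
          = ⁅u, v⁆ ^ k * (⁅u, v⁆ * v * u) * u ^ k := by
            rw [pow_succ, pow_succ']; simp only [mul_assoc]
        _ = ⁅u, v⁆ ^ k * u * (v * u ^ k) := by rw [h₁]; simp only [mul_assoc]
        _ = u * (⁅u, v⁆ ^ k * v * u ^ k) := by
            rw [← (h.pow_right k).eq]; simp only [mul_assoc]
        _ = u ^ (k + 1) * v := by rw [ih, pow_succ', mul_assoc]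
  have h₁ : dist (⁅u, v⁆ ^ k * v) 1 = dist v 1 := by
    rw [← unitary_dist_mul_right (u ^ k), hconj, one_mul, dist_comm, unitary_dist_self_mul]
  have h₂ := dist_triangle (⁅u, v⁆ ^ k) (⁅u, v⁆ ^ k * v) 1
  rw [unitary_dist_self_mul, h₁] at h₂
  linarith

/-! ### Lacunary products and growth -/

/-- Lacunary products built from iterated commutators: `x` is the `m`-fold commutator
`⁅g, ⁅g, … ⁅g, h⁆⁆⁆`, and `F` consists of the products `x₀ ^ i₀ ⋯ xₘ₋₁ ^ iₘ₋₁` with all `iⱼ < M`, where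
`xⱼ` is the `j`-fold commutator.  The separation of `F` on the scale of `x` is what allows a further
factor `x ^ i` with `i < M` to be appended without collisions. -/
theorem exists_separated_products [NormedAlgebra ℝ A] {U : Finset (unitary A)} (h1U : 1 ∈ U)
    (hUinv : U⁻¹ = U) {M r : ℕ} (hM : 1 ≤ M) {g h : unitary A} (hgU : g ∈ U ^ r) (hhU : h ∈ U ^ r)
    (hg : 12 * M * dist g 1 ≤ 1) (hh : 12 * M * dist h 1 ≤ 1) (hgh : ¬ Commute g h) (m : ℕ) :
    ∃ (x : unitary A) (F : Finset (unitary A)), x ∈ U ^ (r * 4 ^ m) ∧ 12 * M * dist x 1 ≤ 1 ∧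
      ¬ Commute g x ∧ F ⊆ U ^ (r * (M * 4 ^ m)) ∧ F.card = M ^ m ∧
      ∀ a ∈ F, ∀ b ∈ F, a ≠ b → 3 * M * dist x 1 ≤ dist a b := by
  have hM' : (1 : ℝ) ≤ M := by exact_mod_cast hM
  induction m with
  | zero =>
    refine ⟨h, {1}, by simpa using hhU, hh, hgh, ?_, by simp, ?_⟩
    · simpa using Finset.one_mem_pow h1U
    · intro a ha b hb hab
      simp_all
  | succ m ih =>
    obtain ⟨x, F, hxU, hx, hgx, hFU, hFcard, hsep⟩ := ih
    have hinv : ∀ {y : unitary A} {s : ℕ}, y ∈ U ^ s → y⁻¹ ∈ U ^ s := by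
      intro y s hy
      rw [← hUinv, inv_pow]
      exact Finset.inv_mem_inv hy
    have hx0 : 0 < dist x 1 := by
      refine dist_pos.2 fun h ↦ hgx ?_
      rw [h]
      exact Commute.one_right g
    have hgx0 : 0 ≤ dist g 1 := dist_nonneg
    have hx4 : dist x 1 ≤ 1 / 4 := by nlinarith
    have hcomm : 6 * M * dist ⁅g, x⁆ 1 ≤ dist x 1 := by
      have := dist_commutatorElement_one_le g x
      calc 6 * M * dist ⁅g, x⁆ 1 ≤ 6 * M * (2 * dist g 1 * dist x 1) := by gcongr
        _ = (12 * M * dist g 1) * dist x 1 := by ring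
        _ ≤ 1 * dist x 1 := by gcongr
        _ = dist x 1 := one_mul _
    have hpow : ∀ {i : ℕ}, i < M → dist (x ^ i) 1 ≤ M * dist x 1 := by
      intro i hi
      refine (unitary_dist_pow_one_le x i).trans ?_
      gcongr
    -- two powers of `x` with distinct exponents below `M`
    have hlt : ∀ (a : unitary A) {i j : ℕ}, i < j → j < M →
        dist x 1 / 2 ≤ dist (a * x ^ i) (a * x ^ j) := by
      intro a i j hij hj
      rw [unitary_dist_mul_left]
      obtain ⟨k, rfl⟩ := Nat.exists_eq_add_of_lt hij
      rw [add_assoc, pow_add, unitary_dist_self_mul]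
      refine half_dist_le_dist_pow_one x (by omega) ?_
      have hk : ((k + 1 : ℕ) : ℝ) ≤ M := by exact_mod_cast (by omega : k + 1 ≤ M)
      nlinarith
    have hmain : ∀ a ∈ F, ∀ b ∈ F, ∀ i < M, ∀ j < M, (a, i) ≠ (b, j) →
        dist x 1 / 2 ≤ dist (a * x ^ i) (b * x ^ j) := by
      intro a ha b hb i hi j hj hne
      by_cases hab : a = b
      · subst hab
        rcases lt_trichotomy i j with hij | hij | hij
        · exact hlt a hij hj
        · exact absurd (by rw [hij]) hne
        · rw [dist_comm (a * x ^ i)]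
          exact hlt a hij hi
      · have h₁ := dist_triangle4 a (a * x ^ i) (b * x ^ j) b
        rw [unitary_dist_self_mul, dist_comm (b * x ^ j) b, unitary_dist_self_mul] at h₁
        nlinarith [hsep a ha b hb hab, hpow hi, hpow hj]
    have hinj : Set.InjOn (fun p : unitary A × ℕ ↦ p.1 * x ^ p.2)
        (F ×ˢ Finset.range M : Finset _) := by
      rintro ⟨a, i⟩ hp ⟨b, j⟩ hq heq
      simp only [Finset.coe_product, Set.mem_prod, Finset.mem_coe, Finset.mem_range] at hp hq
      by_contra hne
      have := hmain a hp.1 b hq.1 i hp.2 j hq.2 hne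
      rw [show a * x ^ i = b * x ^ j from heq, dist_self] at this
      linarith
    refine ⟨⁅g, x⁆, (F ×ˢ Finset.range M).image fun p ↦ p.1 * x ^ p.2, ?_, ?_, ?_, ?_, ?_, ?_⟩
    · have h₁ : g * x * g⁻¹ * x⁻¹ ∈ U ^ (r + r * 4 ^ m + r + r * 4 ^ m) := by
        simp only [pow_add]
        exact Finset.mul_mem_mul (Finset.mul_mem_mul (Finset.mul_mem_mul hgU hxU) (hinv hgU))
          (hinv hxU)
      refine Finset.pow_subset_pow_right h1U ?_ h₁
      have h₂ : r * 1 ≤ r * 4 ^ m := Nat.mul_le_mul_left r (Nat.one_le_pow m 4 (by norm_num))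
      rw [pow_succ, ← mul_assoc]
      omega
    · nlinarith [dist_nonneg (x := ⁅g, x⁆) (y := 1)]
    · exact fun h ↦ hgx (commute_of_commute_commutatorElement hx4 h)
    · intro y hy
      simp only [Finset.mem_image, Finset.mem_product, Finset.mem_range, Prod.exists] at hy
      obtain ⟨a, i, ⟨ha, hi⟩, rfl⟩ := hy
      have h₁ : a * x ^ i ∈ U ^ (r * (M * 4 ^ m) + r * 4 ^ m * i) := by
        rw [pow_add, pow_mul U (r * 4 ^ m)]
        exact Finset.mul_mem_mul (hFU ha) (Finset.pow_mem_pow hxU)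
      refine Finset.pow_subset_pow_right h1U ?_ h₁
      have h₂ : r * 4 ^ m * i ≤ r * 4 ^ m * M := Nat.mul_le_mul_left _ hi.le
      have h₃ : r * (M * 4 ^ (m + 1)) = 4 * (r * 4 ^ m * M) := by ring
      have h₄ : r * (M * 4 ^ m) = r * 4 ^ m * M := by ring
      omega
    · rw [Finset.card_image_of_injOn hinj, Finset.card_product, hFcard, Finset.card_range,
        pow_succ]
    · intro a ha b hb hab
      simp only [Finset.mem_image, Finset.mem_product, Finset.mem_range, Prod.exists] at ha hb
      obtain ⟨a, i, ⟨ha, hi⟩, rfl⟩ := ha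
      obtain ⟨b, j, ⟨hb, hj⟩, rfl⟩ := hb
      have h₁ := hmain a ha b hb i hi j hj (by rintro ⟨⟩; exact hab rfl)
      linarith

/-- Under a growth bound of degree `D`, elements of words in `U` that are sufficiently close to `1`,
in terms of `D` alone, commute. -/
theorem commute_of_card_pow_le [NormedAlgebra ℝ A] {U : Finset (unitary A)} (h1U : 1 ∈ U)
    (hUinv : U⁻¹ = U) {D : ℕ} {B : ℝ} (hB : ∀ r : ℕ, 1 ≤ r → ((U ^ r).card : ℝ) ≤ B * r ^ D)
    {r : ℕ} {g h : unitary A} (hgU : g ∈ U ^ r) (hhU : h ∈ U ^ r)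
    (hg : 12 * 4 ^ (D + 1) * dist g 1 ≤ 1) (hh : 12 * 4 ^ (D + 1) * dist h 1 ≤ 1) :
    Commute g h := by
  by_contra hgh
  -- the radius must be positive for the growth bound to apply
  have hgU' := Finset.pow_subset_pow_right h1U (Nat.le_succ r) hgU
  have hhU' := Finset.pow_subset_pow_right h1U (Nat.le_succ r) hhU
  obtain ⟨m, hm⟩ := pow_unbounded_of_one_lt (B * ((r + 1 : ℕ) * 4 ^ (D + 1)) ^ D)
    (by norm_num : (1 : ℝ) < 4)
  obtain ⟨x, F, -, -, -, hFU, hFcard, -⟩ := exists_separated_products h1U hUinv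
    (M := 4 ^ (D + 1)) (Nat.one_le_pow _ _ (by norm_num)) hgU' hhU' (by exact_mod_cast hg)
    (by exact_mod_cast hh) hgh m
  have h₁ := Finset.card_le_card hFU
  have h₂ := hB ((r + 1) * (4 ^ (D + 1) * 4 ^ m)) (Nat.succ_le_of_lt (by positivity))
  have h₃ : (((4 ^ (D + 1)) ^ m : ℕ) : ℝ) ≤
      B * (((r + 1) * (4 ^ (D + 1) * 4 ^ m) : ℕ) : ℝ) ^ D := by
    rw [← hFcard]
    exact le_trans (by exact_mod_cast h₁) h₂
  have h₄ : (((4 ^ (D + 1)) ^ m : ℕ) : ℝ) = 4 ^ m * (4 ^ m) ^ D := by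
    push_cast
    ring
  have h₅ : B * (((r + 1) * (4 ^ (D + 1) * 4 ^ m) : ℕ) : ℝ) ^ D =
      B * ((r + 1 : ℕ) * 4 ^ (D + 1)) ^ D * (4 ^ m) ^ D := by
    push_cast
    rw [← mul_assoc, mul_pow _ ((4 : ℝ) ^ m), mul_assoc B]
  rw [h₄, h₅] at h₃
  exact absurd (le_of_mul_le_mul_right h₃ (by positivity)) (not_le.2 hm)

end Unitary

/-! ### Polynomial growth with respect to a generating set containing the identity -/

theorem exists_mem_pow_of_mem_closure {G : Type*} [Group G] {U : Finset G}
    (hUinv : U⁻¹ = U) {x : G} (hx : x ∈ Subgroup.closure (U : Set G)) : ∃ r : ℕ, x ∈ U ^ r := by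
  induction hx using Subgroup.closure_induction with
  | mem x hx => exact ⟨1, by simpa using hx⟩
  | one => exact ⟨0, by simp⟩
  | mul x y _ _ hx hy =>
    obtain ⟨r, hr⟩ := hx
    obtain ⟨s, hs⟩ := hy
    exact ⟨r + s, pow_add U r s ▸ Finset.mul_mem_mul hr hs⟩
  | inv x _ hx =>
    obtain ⟨r, hr⟩ := hx
    refine ⟨r, ?_⟩
    rw [← hUinv, inv_pow]
    exact Finset.inv_mem_inv hr

/-- Adjoining `1` to the generating set makes the balls nested, at the cost of raising the degree
by one: the new ball of radius `r` is the union of the old `S ^ i` with `i ≤ r`. -/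
theorem HasPolynomialGrowth.exists_one_mem {G : Type*} [Group G] (hG : HasPolynomialGrowth G) :
    ∃ (U : Finset G) (D : ℕ) (B : ℝ), 1 ∈ U ∧ U⁻¹ = U ∧ Subgroup.closure (U : Set G) = ⊤ ∧
      ∀ r : ℕ, 1 ≤ r → ((U ^ r).card : ℝ) ≤ B * r ^ D := by
  obtain ⟨S, d, B, hSinv, hScl, hSB⟩ := hG
  have hunion : ∀ r : ℕ, (insert 1 S) ^ r ⊆ (Finset.range (r + 1)).biUnion fun i ↦ S ^ i := by
    intro r
    induction r with
    | zero => simp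
    | succ r ih =>
      intro x hx
      rw [pow_succ, Finset.mem_mul] at hx
      obtain ⟨y, hy, z, hz, rfl⟩ := hx
      obtain ⟨i, hi, hyi⟩ := Finset.mem_biUnion.1 (ih hy)
      rw [Finset.mem_range] at hi
      rw [Finset.mem_biUnion]
      rcases Finset.mem_insert.1 hz with rfl | hz
      · exact ⟨i, Finset.mem_range.2 (by omega), by simpa using hyi⟩
      · exact ⟨i + 1, Finset.mem_range.2 (by omega), pow_succ S i ▸ Finset.mul_mem_mul hyi hz⟩
  refine ⟨insert 1 S, ⌈|d|⌉₊ + 1, 1 + |B|, Finset.mem_insert_self _ _, ?_, ?_, ?_⟩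
  · rw [Finset.inv_insert, hSinv, inv_one]
  · rw [eq_top_iff, ← hScl]
    exact Subgroup.closure_mono (by simp)
  · intro r hr
    have hr' : (1 : ℝ) ≤ r := by exact_mod_cast hr
    have hterm : ∀ i ∈ Finset.range r, ((S ^ (i + 1)).card : ℝ) ≤ |B| * r ^ ⌈|d|⌉₊ := by
      intro i hi
      have hi' : ((i + 1 : ℕ) : ℝ) ≤ r := by exact_mod_cast Finset.mem_range.1 hi
      have hi1 : (1 : ℝ) ≤ (i + 1 : ℕ) := by exact_mod_cast Nat.succ_pos i
      calc ((S ^ (i + 1)).card : ℝ) ≤ B * ((i + 1 : ℕ) : ℝ) ^ d := hSB _ (by omega)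
        _ ≤ |B| * ((i + 1 : ℕ) : ℝ) ^ d := by gcongr; exact le_abs_self B
        _ ≤ |B| * ((i + 1 : ℕ) : ℝ) ^ (⌈|d|⌉₊ : ℝ) := by
            gcongr
            exact (le_abs_self d).trans (Nat.le_ceil _)
        _ = |B| * ((i + 1 : ℕ) : ℝ) ^ ⌈|d|⌉₊ := by rw [Real.rpow_natCast]
        _ ≤ |B| * r ^ ⌈|d|⌉₊ := by gcongr
    calc (((insert 1 S) ^ r).card : ℝ)
        ≤ ∑ i ∈ Finset.range (r + 1), ((S ^ i).card : ℝ) := by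
          exact_mod_cast (Finset.card_le_card (hunion r)).trans Finset.card_biUnion_le
      _ = ∑ i ∈ Finset.range r, ((S ^ (i + 1)).card : ℝ) + 1 := by
          rw [Finset.sum_range_succ']
          simp
      _ ≤ r * (|B| * r ^ ⌈|d|⌉₊) + r ^ (⌈|d|⌉₊ + 1) := by
          gcongr
          · simpa using Finset.sum_le_sum hterm
          · exact one_le_pow₀ hr'
      _ = (1 + |B|) * r ^ (⌈|d|⌉₊ + 1) := by ring

/-- In a group of polynomial growth with a faithful unitary representation `ρ`, the elements that `ρ`
sends close enough to `1` commute. -/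
theorem HasPolynomialGrowth.exists_commute_of_dist_lt {G A : Type*} [Group G] [NormedRing A]
    [StarRing A] [CStarRing A] [NormedAlgebra ℝ A] (hG : HasPolynomialGrowth G)
    {ρ : G →* unitary A} (hρ : Function.Injective ρ) :
    ∃ ε > 0, ∀ x y : G, dist (ρ x) 1 < ε → dist (ρ y) 1 < ε → x * y = y * x := by
  obtain ⟨U, D, B, h1U, hUinv, hUcl, hUB⟩ := hG.exists_one_mem
  refine ⟨1 / (12 * 4 ^ (D + 1)), by positivity, fun x y hx hy ↦ ?_⟩
  have hpow (r : ℕ) : (U.image ρ) ^ r = (U ^ r).image ρ := (Finset.image_pow ρ U r).symm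
  obtain ⟨r, hr⟩ := exists_mem_pow_of_mem_closure hUinv (hUcl ▸ Subgroup.mem_top x)
  obtain ⟨s, hs⟩ := exists_mem_pow_of_mem_closure hUinv (hUcl ▸ Subgroup.mem_top y)
  have hxU := Finset.pow_subset_pow_right h1U (le_max_left r s) hr
  have hyU := Finset.pow_subset_pow_right h1U (le_max_right r s) hs
  rw [lt_div_iff₀ (by positivity), mul_comm] at hx hy
  have hcomm : Commute (ρ x) (ρ y) := by
    refine commute_of_card_pow_le (U := U.image ρ) (Finset.mem_image.2 ⟨1, h1U, map_one ρ⟩) ?_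
      (D := D) (B := B) ?_ (r := max r s) ?_ ?_ hx.le hy.le
    · rw [← Finset.image_inv, hUinv]
    · intro k hk
      rw [hpow]
      exact le_trans (by exact_mod_cast Finset.card_image_le) (hUB k hk)
    · rw [hpow]
      exact Finset.mem_image_of_mem ρ hxU
    · rw [hpow]
      exact Finset.mem_image_of_mem ρ hyU
  exact hρ (by simpa using hcomm.eq)

/-! ### Elements near the identity generate a subgroup of finite index -/

theorem finiteIndex_closure_dist_lt {A : Type*} [NormedRing A] [StarRing A] [CStarRing A]
    [ProperSpace A] (G : Subgroup (unitary A)) {ε : ℝ} (hε : 0 < ε) :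
    (Subgroup.closure {x : G | dist (x : unitary A) 1 < ε}).FiniteIndex := by
  set H := Subgroup.closure {x : G | dist (x : unitary A) 1 < ε}
  have htot : TotallyBounded (Set.range fun x : G ↦ ((x : unitary A) : A)) := by
    refine (isCompact_closedBall (0 : A) ‖(1 : A)‖).totallyBounded.subset ?_
    rintro _ ⟨x, rfl⟩
    have := CStarRing.norm_coe_unitary_mul (x : unitary A) (1 : A)
    rw [mul_one] at this
    simp [this]
  obtain ⟨t, ht, hcover⟩ := Metric.totallyBounded_iff.1 htot (ε / 2) (by positivity)
  have hmem : ∀ x : G, ∃ c ∈ t, dist ((x : unitary A) : A) c < ε / 2 := by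
    intro x
    simpa using hcover ⟨x, rfl⟩
  choose c hct hc using hmem
  have : Finite t := ht
  -- representatives of distinct cosets are `ε`-separated, so they lie in distinct balls
  have hinj : Function.Injective fun q : G ⧸ H ↦ (⟨c q.out, hct _⟩ : t) := by
    intro p q hpq
    have hpq' : c p.out = c q.out := congrArg Subtype.val hpq
    rw [← p.out_eq', ← q.out_eq', QuotientGroup.eq]
    refine Subgroup.subset_closure ?_
    have h₁ : dist (((p.out)⁻¹ * q.out : G) : unitary A) 1 =
        dist ((q.out : G) : unitary A) (p.out : G) := by
      rw [← unitary_dist_mul_left ((p.out : G) : unitary A)]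
      simp
    have h₂ := dist_triangle_right (((q.out : G) : unitary A) : A) ((p.out : G) : unitary A)
      (c q.out)
    have h₃ := hc p.out
    rw [hpq'] at h₃
    rw [Set.mem_ofPred_eq, h₁, Subtype.dist_eq]
    linarith [hc q.out]
  have : Finite (G ⧸ H) := Finite.of_injective _ hinj
  exact Subgroup.finiteIndex_of_finite_quotient

open scoped Matrix.Norms.L2Operator in
theorem proposition5p1 (n : ℕ) (G : Subgroup (Matrix.unitaryGroup (Fin n) ℂ))
    (hfg : G.FG) (hG : HasPolynomialGrowth G) : IsVirtuallyAbelian G := by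
  have : ProperSpace (Matrix (Fin n) (Fin n) ℂ) := FiniteDimensional.proper ℂ _
  let : NormedAlgebra ℝ (Matrix (Fin n) (Fin n) ℂ) := NormedAlgebra.restrictScalars ℝ ℂ _
  obtain ⟨ε, hε, hcomm⟩ := hG.exists_commute_of_dist_lt (A := Matrix (Fin n) (Fin n) ℂ)
    G.subtype_injective
  refine ⟨Subgroup.closure {x : G | dist (G.subtype x) 1 < ε}, ?_,
    finiteIndex_closure_dist_lt G hε⟩
  intro x hx y hy
  have := Subgroup.isMulCommutative_closure (k := {x : G | dist (G.subtype x) 1 < ε})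
    fun x hx y hy ↦ hcomm x y hx hy
  exact congrArg Subtype.val (this.is_comm.comm ⟨x, hx⟩ ⟨y, hy⟩)
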